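/- Let $p,q\ge 1$. Consider a linearly observation-driven model of order $(p,q)$, defined as follows. The parameter set $\Theta$ is a set of pairs $\theta=(\vartheta,\varphi)$ with $\vartheta=(\omega,a_{1:p},b_{1:q})\in\mathbb R^{1+p+q}$ and $\varphi$ in an arbitrary set. The latent space $\mathsf X$ is a closed subset of $\mathbb R$, and the observation space $\mathsf Y$ is a measurable space. For $\theta\in\Theta$, $G^\theta$ is a probability kernel from $\mathsf X$ to $\mathsf Y$ with $G^\theta(x;\mathrm dy)=g^\theta(x;y)\,\nu(\mathrm dy)$, where $\nu$ is a $\sigma$-finite measure on $\mathsf Y$ and $g^\theta:\mathsf X\times\mathsf Y\to(0,\infty)$ is measurable. The map $\Upsilon:\mathsf Y\to\mathbb R$ is measurable, and the support of $\nu\circ\Upsilon^{-1}$ contains at least two points. For all $\theta\in\Theta$, $x_{1:p}\in\mathsf X^p$ and $y_{1:q}\in\mathsf Y^q$, the number $\omega+\sum_{i=1}^p a_i x_i+\sum_{i=1}^q b_i\Upsilon(y_i)$ belongs to $\mathsf X$. A stationary solution of the model with parameter $\theta$ is a stationary process $(X_k,Y_k)_{k\in\mathbb Z}$ with values in $\mathsf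 X\times\mathsf Y$ such that, for all $k\in\mathbb Z$, $$X_{k+1}=\omega+\sum_{i=1}^p a_iX_{k+1-i}+\sum_{i=1}^q b_i\Upsilon(Y_{k+1-i})\ \text{ a.s.},\qquad Y_k\mid\mathcal F_k\sim G^\theta(X_k;\cdot),$$ where $\mathcal F_k=\sigma(X_j,\,j\le k;\ Y_j,\,j<k)$. Suppose the following. 1. For every $\theta\in\Theta$ there is a stationary solution, and its law $\mathbb P^\theta$ is unique. Denote by $\tilde{\mathbb P}^\theta$ the law of $(Y_k)_{k\in\mathbb Z}$ and by $\pi_{\mathsf Y}^\theta$ the law of $Y_0$ under $\mathbb P^\theta$. 2. $\int\ln^+|\Upsilon(y)|\,\pi_{\mathsf Y}^\theta(\mathrm dy)<\infty$ for every $\theta\in\Theta$. 3. Let $\theta_\star=(\vartheta_\star,\varphi_\star)\in\Theta$, where $\vartheta_\star=(\omega^\star,a^\star_{1:p},b^\star_{1:q})$. For all $\theta=(\vartheta,\varphi)\in\Theta$ and $x,x'\in\mathsf X$, $G^\theta(x;\cdot)=G^{\theta_\star}(x';\cdot)$ if and only if $\varphi=\varphi_\star$ and $x=x'$. 4. For every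 $\theta\in\Theta$ and every $z\in\mathbb C$ with $|z|\le1$, $1-\sum_{k=1}^pa_kz^k\ne0$. Let $[\theta_\star]=\{\theta\in\Theta:\tilde{\mathbb P}^\theta=\tilde{\mathbb P}^{\theta_\star}\}$ and set $$P(z)=z^p-\sum_{k=1}^pa^\star_kz^{p-k},\qquad Q(z)=\sum_{k=0}^{q-1}b^\star_{k+1}z^{q-1-k}.$$ (i) If $P$ and $Q$ have no common complex root, then $[\theta_\star]=\{\theta_\star\}$. (ii) If $P$ and $Q$ have a common complex root and the set $\{(\omega,a_{1:p},b_{2:q}) : (\omega,a_{1:p},b^\star_1,b_{2:q},\varphi_\star)\in\Theta\}$ contains a neighbourhood of $(\omega^\star,a^\star_{1:p},b^\star_{2:q})$, then $[\theta_\star]$ contains a curve through $\theta_\star$ of positive (finite) length. More precisely, there is a continuous $\gamma:[0,1]\to\mathbb R^{1+p+q}$ of length in $(0,\infty)$ with $\vartheta_\star\in\gamma([0,1])$ and $(\gamma(t),\varphi_\star)\in[\theta_\star]$ for all $t\in[0,1]$. -/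

import Mathlib

open MeasureTheory ProbabilityTheory Set Filter
open scoped Topology ENNReal Polynomial

noncomputable section

/-- An observation-driven model of order `(p, q)` with latent space `X`, observation space `Y` and
parameter space `T`: link functions, observation kernels, and a dominating `σ`-finite measure with
everywhere positive, jointly measurable densities.

The arguments of the link function are listed by increasing lag: entry `0` is the most recent
value of the process. -/
structure ODM (p q : ℕ) (X Y T : Type*) [MeasurableSpace X] [MeasurableSpace Y] where
  /-- The link functions `ψ^θ`. -/
  link : T → (Fin p → X) → (Fin q → Y) → X
  measurable_link : ∀ θ, Measurable fun z : (Fin p → X) × (Fin q → Y) => link θ z.1 z.2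
  /-- The observation kernels `G^θ`. -/
  kernel : T → Kernel X Y
  isMarkovKernel : ∀ θ, IsMarkovKernel (kernel θ)
  /-- The dominating measure. -/
  ν : Measure Y
  sigmaFinite : SigmaFinite ν
  dominated : ∀ θ, ∃ g : X → Y → ℝ, Measurable (Function.uncurry g) ∧ (∀ x y, 0 < g x y) ∧
    ∀ x, kernel θ x = ν.withDensity fun y => ENNReal.ofReal (g x y)

namespace ODM

/-- On the path space `(X × Y)^ℤ`, the `σ`-field `F_k` generated by the `X_j`, `j ≤ k`, and the
`Y_j`, `j < k`. -/
@[reducible] def past (X Y : Type*) [MeasurableSpace X] [MeasurableSpace Y] (k : ℤ) :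
    MeasurableSpace (ℤ → X × Y) :=
  (⨆ j : Iic k, MeasurableSpace.comap (fun w : ℤ → X × Y => (w j).1) inferInstance) ⊔
    ⨆ j : Iio k, MeasurableSpace.comap (fun w : ℤ → X × Y => (w j).2) inferInstance

theorem past_le (X Y : Type*) [MeasurableSpace X] [MeasurableSpace Y] (k : ℤ) :
    past X Y k ≤ MeasurableSpace.pi := by
  refine sup_le (iSup_le fun j => ?_) (iSup_le fun j => ?_)
  · exact Measurable.comap_le (measurable_fst.comp (measurable_pi_apply (j : ℤ)))
  · exact Measurable.comap_le (measurable_snd.comp (measurable_pi_apply (j : ℤ)))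

variable {p q : ℕ} {X Y T : Type*} [MeasurableSpace X] [MeasurableSpace Y]

/-- `P` is the law on `(X × Y)^ℤ` of a stationary solution of the model with parameter `θ`:
it is shift invariant, `X_{k+1} = ψ^θ(X_k, …, X_{k-p+1}; Y_k, …, Y_{k-q+1})` almost surely, and the
conditional distribution of `Y_k` given `F_k` is `G^θ(X_k; ·)`, for every `k ∈ ℤ`. -/
structure IsStationarySolution (M : ODM p q X Y T) (θ : T) (P : Measure (ℤ → X × Y)) : Prop where
  isProbabilityMeasure : IsProbabilityMeasure P
  stationary : P.map (fun w k => w (k + 1)) = P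
  link_eq : ∀ k : ℤ, ∀ᵐ w ∂P, (w (k + 1)).1 =
    M.link θ (fun i => (w (k - ((i : ℕ) : ℤ))).1) (fun j => (w (k - ((j : ℕ) : ℤ))).2)
  cond_law : ∀ k : ℤ, ∀ A : Set Y, MeasurableSet A →
    P[((fun w : ℤ → X × Y => (w k).2) ⁻¹' A).indicator (fun _ => (1 : ℝ)) | past X Y k]
      =ᵐ[P] fun w => (M.kernel θ (w k).1).real A

/-- For every parameter, there is exactly one (law of a) stationary solution. -/
def UniquelyStationary (M : ODM p q X Y T) : Prop :=
  ∀ θ, ∃! P : Measure (ℤ → X × Y), M.IsStationarySolution θ P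

/-- The stationary law `ℙ^θ` on `(X × Y)^ℤ`. -/
def stationaryLaw (M : ODM p q X Y T) (h : M.UniquelyStationary) (θ : T) :
    Measure (ℤ → X × Y) :=
  (h θ).exists.choose

theorem stationaryLaw_spec (M : ODM p q X Y T) (h : M.UniquelyStationary) (θ : T) :
    M.IsStationarySolution θ (M.stationaryLaw h θ) :=
  (h θ).exists.choose_spec

/-- The law of the observations `(Y_k)_{k ∈ ℤ}` under `ℙ^θ`. -/
def observationLaw (M : ODM p q X Y T) (h : M.UniquelyStationary) (θ : T) : Measure (ℤ → Y) :=
  (M.stationaryLaw h θ).map fun w k => (w k).2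

/-- The law `π_Y^θ` of `Y_0` under `ℙ^θ`. -/
def observationMarginal (M : ODM p q X Y T) (h : M.UniquelyStationary) (θ : T) : Measure Y :=
  (M.stationaryLaw h θ).map fun w => (w 0).2

/-- The equivalence class `[θ]` of the parameters having the same law of observations as `θ`. -/
def equivClass (M : ODM p q X Y T) (h : M.UniquelyStationary) (θ : T) : Set T :=
  {θ' | M.observationLaw h θ' = M.observationLaw h θ}

end ODM

/-- The space `ℝ^{1+p+q}` of linear parameters `ϑ = (ω, a_1, …, a_p, b_1, …, b_q)`. -/
abbrev LinParam (p q : ℕ) : Type := EuclideanSpace ℝ (Unit ⊕ Fin p ⊕ Fin q)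

namespace LinParam

variable {p q : ℕ}

/-- The intercept `ω`. -/
def omega (v : LinParam p q) : ℝ := v (Sum.inl ())

/-- The autoregressive coefficients: `v.a i` is `a_{i+1}`. -/
def a (v : LinParam p q) (i : Fin p) : ℝ := v (Sum.inr (Sum.inl i))

/-- The coefficients of the observations: `v.b j` is `b_{j+1}`. -/
def b (v : LinParam p q) (j : Fin q) : ℝ := v (Sum.inr (Sum.inr j))

end LinParam

/-- A linearly observation-driven model of order `(p, q)`, with parameters `θ = (ϑ, φ)`,
`ϑ ∈ ℝ^{1+p+q}` and `φ ∈ Φ`. The latent space is a closed subset of `ℝ` and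
`X_{k+1} = ω + ∑_{i=1}^p a_i X_{k+1-i} + ∑_{j=1}^q b_j Υ(Y_{k+1-j})`. -/
structure LODM (p q : ℕ) (Y Φ : Type*) [MeasurableSpace Y] where
  /-- The latent space. -/
  latent : Set ℝ
  isClosed_latent : IsClosed latent
  /-- The parameter set `Θ`. -/
  Θ : Set (LinParam p q × Φ)
  /-- The underlying observation-driven model. -/
  toODM : ODM p q latent Y Θ
  /-- The mapping `Υ`. -/
  Υ : Y → ℝ
  measurable_Υ : Measurable Υ
  /-- The image measure of `ν` by `Υ` has at least two points in its support. -/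
  nondegenerate : ((toODM.ν).map Υ).support.Nontrivial
  link_affine : ∀ (θ : Θ) (x : Fin p → latent) (y : Fin q → Y),
    (toODM.link θ x y : ℝ) =
      θ.1.1.omega + ∑ i, θ.1.1.a i * (x i : ℝ) + ∑ j, θ.1.1.b j * Υ (y j)

/-- The set `S_p` of the `c ∈ ℝ^p` such that `1 - ∑_{k=1}^p c_k z^k` has no root in the closed
complex unit disc. -/
def invertibleCoeffs (p : ℕ) : Set (Fin p → ℝ) :=
  {c | ∀ z : ℂ, ‖z‖ ≤ 1 → 1 - ∑ k : Fin p, (c k : ℂ) * z ^ ((k : ℕ) + 1) ≠ 0}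

/-- `P_p(z; a) = z^p - ∑_{k=1}^p a_k z^{p-k}`. -/
def polyP {p : ℕ} (a : Fin p → ℝ) : ℝ[X] :=
  Polynomial.X ^ p - ∑ k : Fin p, Polynomial.C (a k) * Polynomial.X ^ (p - ((k : ℕ) + 1))

/-- `Q_q(z; b) = ∑_{k=0}^{q-1} b_{k+1} z^{q-1-k}`. -/
def polyQ {q : ℕ} (b : Fin q → ℝ) : ℝ[X] :=
  ∑ k : Fin q, Polynomial.C (b k) * Polynomial.X ^ (q - 1 - (k : ℕ))

/-- The two real polynomials share a complex root. -/
def HaveCommonRoot (P Q : ℝ[X]) : Prop :=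
  ∃ z : ℂ, Polynomial.aeval z P = 0 ∧ Polynomial.aeval z Q = 0

end

/-! Write `U` for the shift, acting by composition on functions on path space. With `X` the latent
variable at time 0 and `Υ` the transformed observation, the recursion reads `U^q P(U) X = ω + U^p
Q(U) Υ`, so that identification becomes a question about real polynomials.

Since `1 - ∑ a_k z^k` has no root in the closed disc, the recursion can be solved backwards: the
latent variable is a measurable function of the past observations (`exists_measurable_state`). The
joint law of the past and of `Y_0` then has an explicit density with respect to (law of the past) ⊗
`ν` (`map_pastObs_obs`). If `θ` and `θ⋆` give the same law of observations, the densities agree,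
hence so do the kernels at the two reconstructed states. Thus `φ = φ⋆`, both states are the same
function of the past, and the solution for `θ` also satisfies the recursion of `θ⋆`
(`recursion_of_map_obs_eq`).

For (i), eliminating the latent variable between the two recursions makes a polynomial in `U` send
`Υ` to a constant. Such a polynomial vanishes (`eq_zero_of_aeval_obs`), so `P⋆ Q = P Q⋆`, and
coprimality of `P⋆` and `Q⋆` forces equality (`eq_of_recursion`).

For (ii), a common real factor `D` can be cancelled, because `D(U)` is injective when the roots of
`D` lie in the open disc. Adding any multiple of the reduced recursion to the original one gives a
line of parameters satisfied by the same process (`exists_direction`); uniqueness of the stationary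
law concludes. -/

noncomputable section

/-! ### Polynomials in the composition operator of a measure preserving map -/

/-- The composition operator `f ↦ f ∘ T` on functions with values in `R`. -/
def koopman (R : Type*) [CommRing R] {Ω : Type*} (T : Ω → Ω) : Module.End R (Ω → R) :=
  LinearMap.funLeft R R T

theorem koopman_pow_apply {R : Type*} [CommRing R] {Ω : Type*} (T : Ω → Ω) (n : ℕ) (f : Ω → R)
    (w : Ω) : (koopman R T ^ n) f w = f (T^[n] w) := by
  induction n generalizing w with
  | zero => simp
  | succ n ih =>
    rw [pow_succ', Module.End.mul_apply, Function.iterate_succ_apply, ← ih]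
    rfl

theorem aeval_koopman_apply {R : Type*} [CommRing R] {Ω : Type*} (T : Ω → Ω) (p : R[X])
    (f : Ω → R) (w : Ω) :
    Polynomial.aeval (koopman R T) p f w =
      ∑ n ∈ Finset.range (p.natDegree + 1), p.coeff n * f (T^[n] w) := by
  simp [Polynomial.aeval_eq_sum_range, LinearMap.sum_apply, Finset.sum_apply, koopman_pow_apply]

theorem aeval_koopman_const {R : Type*} [CommRing R] {Ω : Type*} (T : Ω → Ω) (p : R[X]) (c : R) :
    Polynomial.aeval (koopman R T) p (fun _ => c) = fun _ => p.eval 1 * c := by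
  funext w
  simp [aeval_koopman_apply, Polynomial.eval_eq_sum_range, Finset.sum_mul]

theorem aeval_koopman_ofReal {Ω : Type*} (T : Ω → Ω) (p : ℝ[X]) (f : Ω → ℝ) (w : Ω) :
    Polynomial.aeval (koopman ℂ T) (p.map (algebraMap ℝ ℂ)) (fun w => (f w : ℂ)) w =
      (Polynomial.aeval (koopman ℝ T) p f w : ℂ) := by
  rw [aeval_koopman_apply, aeval_koopman_apply]
  simp

theorem measurable_aeval_koopman {𝕜 : Type*} [RCLike 𝕜] {Ω : Type*} [MeasurableSpace Ω]
    {T : Ω → Ω} (hT : Measurable T) (p : 𝕜[X]) {f : Ω → 𝕜} (hf : Measurable f) :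
    Measurable (Polynomial.aeval (koopman 𝕜 T) p f) := by
  have h : Polynomial.aeval (koopman 𝕜 T) p f = fun w =>
      ∑ n ∈ Finset.range (p.natDegree + 1), p.coeff n * f (T^[n] w) :=
    funext fun w => aeval_koopman_apply T p f w
  rw [h]
  exact Finset.measurable_sum _ fun n _ => (hf.comp (hT.iterate n)).const_mul _

theorem aeval_koopman_congr {R : Type*} [CommRing R] {Ω : Type*} [MeasurableSpace Ω]
    {μ : Measure Ω} {T : Ω → Ω} (hT : MeasurePreserving T μ μ) (p : R[X]) {f g : Ω → R}
    (h : f =ᵐ[μ] g) :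
    Polynomial.aeval (koopman R T) p f =ᵐ[μ] Polynomial.aeval (koopman R T) p g := by
  have h' : ∀ᵐ w ∂μ, ∀ n : ℕ, f (T^[n] w) = g (T^[n] w) :=
    ae_all_iff.2 fun n => (hT.iterate n).quasiMeasurePreserving.ae_eq_comp h
  filter_upwards [h'] with w hw
  simp [aeval_koopman_apply, hw]

theorem aeval_koopman_X_sub_C_mul {R : Type*} [CommRing R] {Ω : Type*} (T : Ω → Ω) (r : R)
    (p : R[X]) (f : Ω → R) (w : Ω) :
    Polynomial.aeval (koopman R T) ((Polynomial.X - Polynomial.C r) * p) f w =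
      Polynomial.aeval (koopman R T) p f (T w) - r * Polynomial.aeval (koopman R T) p f w := by
  simp [koopman, LinearMap.funLeft]

/-- Induction on the roots of a nonzero complex polynomial. -/
theorem induction_on_complex_roots {C : ℂ[X] → Prop} (hC : ∀ c : ℂ, c ≠ 0 → C (Polynomial.C c))
    (S : Set ℂ) (hmul : ∀ r ∈ S, ∀ B, C B → C ((Polynomial.X - Polynomial.C r) * B))
    (A : ℂ[X]) (h0 : A ≠ 0) (hA : ∀ z, A.IsRoot z → z ∈ S) : C A := by
  induction hn : A.natDegree generalizing A with
  | zero =>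
    rw [Polynomial.eq_C_of_natDegree_eq_zero hn] at h0 ⊢
    exact hC _ fun h => h0 (by rw [h, Polynomial.C_0])
  | succ n ih =>
    obtain ⟨r, hr⟩ := IsAlgClosed.exists_root A
      (fun h => by simp [Polynomial.natDegree_eq_of_degree_eq_some h] at hn)
    obtain ⟨B, rfl⟩ := Polynomial.dvd_iff_isRoot.2 hr
    have hB : B ≠ 0 := right_ne_zero_of_mul h0
    refine hmul r (hA r hr) B (ih B hB (fun z hz => hA z (by simp_all)) ?_)
    rw [Polynomial.natDegree_mul (Polynomial.X_sub_C_ne_zero r) hB,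
      Polynomial.natDegree_X_sub_C] at hn
    omega

/-- By invariance `s ^ n * f ∘ T^[n]` has the law of `s ^ n * f`, which tends to 0 pointwise.
Convergence in measure to a constant depends only on the laws. -/
theorem tendstoInMeasure_pow_mul_iterate {Ω : Type*} [MeasurableSpace Ω] {μ : Measure Ω}
    [IsFiniteMeasure μ] {T : Ω → Ω} (hT : MeasurePreserving T μ μ) {s : ℂ} (hs : ‖s‖ < 1)
    {f : Ω → ℂ} (hf : Measurable f) :
    TendstoInMeasure μ (fun (n : ℕ) w => s ^ n * f (T^[n] w)) atTop 0 := by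
  have h1 : TendstoInMeasure μ (fun (n : ℕ) w => s ^ n * f w) atTop 0 := by
    refine tendstoInMeasure_of_tendsto_ae
      (fun n => (hf.const_mul _).aestronglyMeasurable) (Eventually.of_forall fun w => ?_)
    simpa using (tendsto_pow_atTop_nhds_zero_of_norm_lt_one hs).mul_const (f w)
  intro ε hε
  refine (h1 ε hε).congr fun n => ?_
  have hm : MeasurableSet {w | ε ≤ edist (s ^ n * f w) ((0 : Ω → ℂ) w)} :=
    measurableSet_le measurable_const ((hf.const_mul _).edist measurable_const)
  exact ((hT.iterate n).measure_preimage hm.nullMeasurableSet).symm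

/-- With `g = f ∘ S - r f`, iterating `f = r⁻¹ (f ∘ S - g)` writes `f` as an `m`-measurable sum plus
the remainder `r⁻¹ ^ n * f ∘ S^[n]`. The remainder tends to 0 in measure, hence almost surely along
a subsequence. -/
theorem aestronglyMeasurable_of_comp_sub_mul {Ω : Type*} {m m0 : MeasurableSpace Ω}
    {μ : Measure Ω} [IsFiniteMeasure μ] {S : Ω → Ω} (hS : MeasurePreserving S μ μ)
    (hSm : Measurable[m, m] S) {r : ℂ} (hr : 1 < ‖r‖) {f : Ω → ℂ} (hf : Measurable f)
    (hg : AEStronglyMeasurable[m] (fun w => f (S w) - r * f w) μ) :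
    AEStronglyMeasurable[m] f μ := by
  have hr0 : r ≠ 0 := norm_pos_iff.1 (one_pos.trans hr)
  have hgn : ∀ n : ℕ, AEStronglyMeasurable[m]
      (fun w => f (S (S^[n] w)) - r * f (S^[n] w)) μ := by
    intro n
    obtain ⟨g, hg1, hg2⟩ := hg
    exact ⟨g ∘ S^[n], hg1.comp_measurable (hSm.iterate n),
      (hS.iterate n).quasiMeasurePreserving.ae_eq_comp hg2⟩
  have hn : ∀ n : ℕ, AEStronglyMeasurable[m] (fun w => f w - r⁻¹ ^ n * f (S^[n] w)) μ := by
    intro n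
    induction n with
    | zero => simpa using aestronglyMeasurable_const
    | succ n ih =>
      refine (ih.sub ((hgn n).const_mul (r⁻¹ ^ (n + 1)))).congr (Eventually.of_forall fun w => ?_)
      simp only [Function.iterate_succ_apply', Pi.sub_apply, pow_succ]
      linear_combination r⁻¹ ^ n * f (S^[n] w) * inv_mul_cancel₀ hr0
  have ht := tendstoInMeasure_pow_mul_iterate hS (s := r⁻¹)
    (by rw [norm_inv]; exact inv_lt_one_of_one_lt₀ hr) hf
  obtain ⟨ns, -, hns⟩ := ht.exists_seq_tendsto_ae
  choose g hg1 hg2 using hn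
  refine ⟨fun w => limUnder atTop fun i => g (ns i) w,
    @StronglyMeasurable.limUnder _ _ _ m _ _ _ _ _ _ _ fun i => hg1 (ns i), ?_⟩
  filter_upwards [hns, ae_all_iff.2 hg2] with w hw hw'
  refine (Tendsto.limUnder_eq ?_).symm
  simp_rw [← hw']
  simpa using hw.const_sub (f w)

/-- The linear factors of `A` are inverted one at a time. -/
theorem aestronglyMeasurable_of_aeval_koopman {Ω : Type*} {m m0 : MeasurableSpace Ω}
    {μ : Measure Ω} [IsFiniteMeasure μ] {S : Ω → Ω} (hS : MeasurePreserving S μ μ)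
    (hSm : Measurable[m, m] S) {f : Ω → ℂ} (hf : Measurable f) (A : ℂ[X]) (h0 : A ≠ 0)
    (hA : ∀ z, A.IsRoot z → 1 < ‖z‖)
    (h : AEStronglyMeasurable[m] (Polynomial.aeval (koopman ℂ S) A f) μ) :
    AEStronglyMeasurable[m] f μ := by
  refine induction_on_complex_roots
    (C := fun A => AEStronglyMeasurable[m] (Polynomial.aeval (koopman ℂ S) A f) μ →
      AEStronglyMeasurable[m] f μ) (fun c hc h => ?_) {z | 1 < ‖z‖} (fun r hr B hB h => ?_)
      A h0 hA h
  · refine (h.const_mul c⁻¹).congr (Eventually.of_forall fun w => ?_)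
    simp [hc]
  · refine hB (aestronglyMeasurable_of_comp_sub_mul hS hSm hr
      (measurable_aeval_koopman hS.measurable B hf) (h.congr (Eventually.of_forall fun w => ?_)))
    exact aeval_koopman_X_sub_C_mul S r B f w

/-- Linear factors are removed one at a time. If `g ∘ T = r g` with `‖r‖ < 1`, then `g ∘ T^[n] = r ^
n g` tends to 0, while all `g ∘ T^[n]` have the law of `g`; so `g = 0` almost surely. -/
theorem ae_eq_zero_of_aeval_koopman {Ω : Type*} [MeasurableSpace Ω]
    {μ : Measure Ω} [IsFiniteMeasure μ] {T : Ω → Ω} (hT : MeasurePreserving T μ μ)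
    {f : Ω → ℂ} (hf : Measurable f) (A : ℂ[X]) (h0 : A ≠ 0)
    (hA : ∀ z, A.IsRoot z → ‖z‖ < 1)
    (h : Polynomial.aeval (koopman ℂ T) A f =ᵐ[μ] 0) : f =ᵐ[μ] 0 := by
  refine induction_on_complex_roots
    (C := fun A => Polynomial.aeval (koopman ℂ T) A f =ᵐ[μ] 0 → f =ᵐ[μ] 0)
    (fun c hc h => ?_) {z | ‖z‖ < 1} (fun r hr B hB h => hB ?_) A h0 hA h
  · filter_upwards [h] with w hw
    simpa [hc] using hw
  · have hg := measurable_aeval_koopman hT.measurable B hf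
    set g := Polynomial.aeval (koopman ℂ T) B f with hgdef
    have h1 : ∀ n : ℕ, ∀ᵐ w ∂μ, g (T^[n] w) = r ^ n * g w := by
      intro n
      induction n with
      | zero => simp
      | succ n ih =>
        filter_upwards [ih, (hT.iterate n).quasiMeasurePreserving.ae_eq_comp h] with w hw hw'
        have := aeval_koopman_X_sub_C_mul T r B f (T^[n] w)
        simp only [Function.comp_apply, Pi.zero_apply] at hw'
        rw [hw', eq_comm, sub_eq_zero, ← hgdef] at this
        rw [Function.iterate_succ_apply', this, hw, pow_succ']
        ring
    have hlim : ∀ᵐ w ∂μ, Tendsto (fun n : ℕ => g (T^[n] w)) atTop (𝓝 0) := by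
      filter_upwards [ae_all_iff.2 h1] with w hw
      simp_rw [hw]
      simpa using (tendsto_pow_atTop_nhds_zero_of_norm_lt_one hr).mul_const (g w)
    have hm : TendstoInMeasure μ (fun (n : ℕ) w => g (T^[n] w)) atTop (0 : Ω → ℂ) :=
      tendstoInMeasure_of_tendsto_ae
        (fun n => (hg.comp (hT.measurable.iterate n)).aestronglyMeasurable) hlim
    have hm' : TendstoInMeasure μ (fun (_ : ℕ) w => g w) atTop (0 : Ω → ℂ) := by
      intro ε hε
      refine (hm ε hε).congr fun n => ?_
      have hms : MeasurableSet {w | ε ≤ edist (g w) ((0 : Ω → ℂ) w)} :=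
        measurableSet_le measurable_const (hg.edist measurable_const)
      exact (hT.iterate n).measure_preimage hms.nullMeasurableSet
    exact tendstoInMeasure_ae_unique
      (tendstoInMeasure_of_tendsto_ae (fun _ => hg.aestronglyMeasurable)
        (Eventually.of_forall fun w => tendsto_const_nhds)) hm'

/-! ### Shifts of two-sided sequences -/

/-- The shift `w ↦ w (· + j)` of two-sided sequences. -/
def shift {E : Type*} (j : ℤ) (w : ℤ → E) : ℤ → E := fun k => w (k + j)

theorem shift_shift {E : Type*} (i j : ℤ) (w : ℤ → E) : shift i (shift j w) = shift (i + j) w := by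
  funext k
  simp [shift, add_assoc]

theorem shift_iterate {E : Type*} (j : ℤ) (n : ℕ) (w : ℤ → E) :
    (shift j)^[n] w = shift (n * j) w := by
  induction n with
  | zero => funext k; simp [shift]
  | succ n ih =>
    rw [Function.iterate_succ_apply', ih, shift_shift]
    congr 1
    push_cast
    ring

theorem measurable_shift {E : Type*} [MeasurableSpace E] (j : ℤ) :
    Measurable (shift (E := E) j) :=
  measurable_pi_lambda _ fun k => measurable_pi_apply (k + j)

theorem measurePreserving_shift {E : Type*} [MeasurableSpace E] {P : Measure (ℤ → E)}
    (h : P.map (fun w k => w (k + 1)) = P) (j : ℤ) : MeasurePreserving (shift j) P P := by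
  have h1 : MeasurePreserving (shift (E := E) 1) P P := ⟨measurable_shift 1, h⟩
  have h0 : MeasurePreserving (shift (E := E) (-1)) P P := by
    refine ⟨measurable_shift _, ?_⟩
    conv_lhs => rw [← h1.map_eq]
    rw [Measure.map_map (measurable_shift _) (measurable_shift _)]
    have : (shift (E := E) (-1)) ∘ shift 1 = id := by
      funext w k
      simp [shift]
    rw [this, Measure.map_id]
  obtain ⟨n, rfl | rfl⟩ := j.eq_nat_or_neg
  · have := h1.iterate n
    rwa [show (shift (E := E) 1)^[n] = shift n by funext w; simp [shift_iterate]] at this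
  · have := h0.iterate n
    rwa [show (shift (E := E) (-1))^[n] = shift (-n) by funext w; simp [shift_iterate]] at this

/-! ### The linear recursion -/

namespace LODM

variable {p q : ℕ} {Y Φ : Type*} [MeasurableSpace Y] (M : LODM p q Y Φ)

/-- The latent variable at time `0`. -/
def state (w : ℤ → M.latent × Y) : ℝ := (w 0).1

/-- The transformed observation at time `0`. -/
def obs (w : ℤ → M.latent × Y) : ℝ := M.Υ (w 0).2

theorem measurable_state : Measurable M.state :=
  measurable_subtype_coe.comp (measurable_fst.comp (measurable_pi_apply 0))

theorem measurable_obs : Measurable M.obs :=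
  M.measurable_Υ.comp (measurable_snd.comp (measurable_pi_apply 0))

/-- The linear recursion with parameter `v` holds almost surely, at all times. -/
def Recursion (v : LinParam p q) (P : Measure (ℤ → M.latent × Y)) : Prop :=
  ∀ k : ℤ, ∀ᵐ w ∂P, ((w (k + 1)).1 : ℝ) = v.omega +
    ∑ i, v.a i * ((w (k - ((i : ℕ) : ℤ))).1 : ℝ) + ∑ j, v.b j * M.Υ (w (k - ((j : ℕ) : ℤ))).2

variable {M}

theorem recursion_of_isStationarySolution {θ : M.Θ} {P : Measure (ℤ → M.latent × Y)}
    (h : M.toODM.IsStationarySolution θ P) : M.Recursion θ.1.1 P := by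
  intro k
  filter_upwards [h.link_eq k] with w hw
  rw [hw, M.link_affine]

/-- The factors `X ^ q` here and `X ^ p` for the observations place both sides at a common time:
they are the two sides of the recursion at `k = p + q - 1`. -/
theorem aeval_polyP_state (a : Fin p → ℝ) (w : ℤ → M.latent × Y) :
    Polynomial.aeval (koopman ℝ (shift 1)) (Polynomial.X ^ q * polyP a) M.state w =
      ((w (p + q)).1 : ℝ) - ∑ i, a i * ((w (p + q - 1 - ((i : ℕ) : ℤ))).1 : ℝ) := by
  simp only [polyP, mul_sub, Finset.mul_sum, map_sub, map_sum, map_mul, map_pow,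
    Polynomial.aeval_X, Polynomial.aeval_C, LinearMap.sub_apply, LinearMap.sum_apply, Pi.sub_apply,
    Finset.sum_apply]
  simp only [Module.End.mul_apply, koopman_pow_apply, shift_iterate, state, shift,
    Module.algebraMap_end_apply, Pi.smul_apply, smul_eq_mul]
  congr 1
  · congr 3
    ring
  · refine Finset.sum_congr rfl fun i _ => ?_
    congr 4
    have := i.2
    omega

theorem aeval_polyQ_obs (b : Fin q → ℝ) (w : ℤ → M.latent × Y) :
    Polynomial.aeval (koopman ℝ (shift 1)) (Polynomial.X ^ p * polyQ b) M.obs w =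
      ∑ j, b j * M.Υ (w (p + q - 1 - ((j : ℕ) : ℤ))).2 := by
  simp only [polyQ, Finset.mul_sum, map_sum, map_mul, map_pow,
    Polynomial.aeval_X, Polynomial.aeval_C, LinearMap.sum_apply,
    Finset.sum_apply]
  simp only [Module.End.mul_apply, koopman_pow_apply, shift_iterate, obs, shift,
    Module.algebraMap_end_apply, Pi.smul_apply, smul_eq_mul]
  refine Finset.sum_congr rfl fun i _ => ?_
  congr 4
  have := i.2
  omega

theorem recursion_iff {v : LinParam p q} {P : Measure (ℤ → M.latent × Y)}
    (hP : P.map (fun w k => w (k + 1)) = P) :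
    M.Recursion v P ↔
      ∀ᵐ w ∂P, Polynomial.aeval (koopman ℝ (shift 1)) (Polynomial.X ^ q * polyP v.a) M.state w =
        v.omega +
          Polynomial.aeval (koopman ℝ (shift 1)) (Polynomial.X ^ p * polyQ v.b) M.obs w := by
  simp only [aeval_polyP_state, aeval_polyQ_obs]
  constructor
  · intro h
    filter_upwards [h (p + q - 1)] with w hw
    rw [sub_add_cancel] at hw
    rw [hw]
    ring
  · intro h k
    filter_upwards [(measurePreserving_shift hP (k + 1 - (p + q))).quasiMeasurePreserving.ae h]
      with w hw
    have h1 : ∀ i : ℤ, (p + q : ℤ) - 1 - i + (k + 1 - (p + q)) = k - i := fun i => by ring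
    simp only [shift, h1, add_sub_cancel] at hw
    linear_combination hw

/-! ### The latent variable is a function of the past observations -/

/-- The observations before time `0`, the most recent one first. -/
def pastObs {X Y : Type*} (w : ℤ → X × Y) : ℕ → Y := fun n => (w (-1 - n)).2

theorem measurable_pastObs {X Y : Type*} [MeasurableSpace X] [MeasurableSpace Y] :
    Measurable (pastObs : (ℤ → X × Y) → ℕ → Y) :=
  measurable_pi_lambda _ fun _ => measurable_snd.comp (measurable_pi_apply _)

/-- In the backward shift, `1 - ∑ a_k z^k` maps the latent variable to a function of the past
observations. Its roots lie outside the closed disc, so it can be inverted without leaving the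
σ-field of the past. -/
theorem exists_measurable_state {v : LinParam p q} {P : Measure (ℤ → M.latent × Y)}
    [IsProbabilityMeasure P] (hP : P.map (fun w k => w (k + 1)) = P) (hrec : M.Recursion v P)
    (ha : v.a ∈ invertibleCoeffs p) :
    ∃ z : (ℕ → Y) → M.latent, Measurable z ∧ ∀ᵐ w ∂P, (w 0).1 = z (pastObs w) := by
  classical
  set m : MeasurableSpace (ℤ → M.latent × Y) := MeasurableSpace.comap pastObs inferInstance
  have hH : Measurable[m] (pastObs : (ℤ → M.latent × Y) → ℕ → Y) := comap_measurable _
  have hSm : Measurable[m, m] (shift (E := M.latent × Y) (-1)) := by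
    rintro - ⟨s, hs, rfl⟩
    -- Moving one step back in time forgets the most recent past observation.
    refine ⟨(fun h n => h (n + 1)) ⁻¹' s,
      (measurable_pi_lambda _ fun n => measurable_pi_apply (n + 1)) hs, ?_⟩
    ext w
    have : (fun n => pastObs w (n + 1)) = pastObs (shift (-1) w) := by
      funext n
      simp only [pastObs, shift]
      congr 2
      push_cast
      ring
    simp [this]
  set A : ℂ[X] := 1 - ∑ k : Fin p, Polynomial.C (v.a k : ℂ) * Polynomial.X ^ ((k : ℕ) + 1) with hAdef
  have hA : ∀ z, A.eval z = 1 - ∑ k : Fin p, (v.a k : ℂ) * z ^ ((k : ℕ) + 1) := fun z => by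
    simp [hAdef, Polynomial.eval_finsetSum]
  have hroot : ∀ z, A.IsRoot z → 1 < ‖z‖ := by
    intro z hz
    by_contra hle
    exact ha z (not_lt.1 hle) (by rw [← hA]; exact hz)
  have hA0 : A ≠ 0 := by
    intro h
    have := hroot 0 (by simp [h])
    simp at this
    linarith
  have hmeas : AEStronglyMeasurable[m] (fun w => (M.state w : ℂ)) P := by
    refine aestronglyMeasurable_of_aeval_koopman
      (measurePreserving_shift hP (-1)) hSm (Complex.measurable_ofReal.comp M.measurable_state)
      A hA0 hroot ?_
    refine ⟨fun w => ((v.omega + ∑ j : Fin q, v.b j * M.Υ (pastObs w j) : ℝ) : ℂ),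
      Measurable.stronglyMeasurable ?_, ?_⟩
    · refine Complex.measurable_ofReal.comp (measurable_const.add
        (Finset.measurable_sum _ fun j _ => ?_))
      exact (M.measurable_Υ.comp ((measurable_pi_apply (j : ℕ)).comp hH)).const_mul _
    · filter_upwards [hrec (-1)] with w hw
      simp only [hAdef, map_sub, map_sum, map_mul, map_pow, map_one,
        Polynomial.aeval_X, Polynomial.aeval_C, LinearMap.sub_apply, LinearMap.sum_apply,
        Pi.sub_apply, Finset.sum_apply]
      simp only [Module.End.mul_apply, Module.End.one_apply, koopman_pow_apply, shift_iterate,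
        state, shift, Module.algebraMap_end_apply, Pi.smul_apply, smul_eq_mul]
      rw [show (w 0).1 = (w (-1 + 1)).1 by simp, hw]
      have h1 : ∀ x : Fin p, (0 : ℤ) + ((x : ℕ) + 1 : ℕ) * (-1) = -1 - ((x : ℕ) : ℤ) := fun x => by
        push_cast
        ring
      simp only [h1, pastObs]
      push_cast
      ring
  obtain ⟨F, hF, hFe⟩ := hmeas
  obtain ⟨z, hz, rfl⟩ := hF.measurable.exists_eq_measurable_comp
  obtain ⟨w₀⟩ : Nonempty (ℤ → M.latent × Y) := P.nonempty_of_neZero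
  have hz' : Measurable fun h => (z h).re := Complex.measurable_re.comp hz
  -- The reconstruction is complex-valued and lies in the latent space only almost surely; elsewhere
  -- an arbitrary latent point is used.
  refine ⟨fun h => if hh : (z h).re ∈ M.latent then ⟨(z h).re, hh⟩ else (w₀ 0).1, ?_, ?_⟩
  · exact Measurable.dite (s := {h | (z h).re ∈ M.latent})
      (f := fun h => ⟨(z h.1).re, h.2⟩) (g := fun _ => (w₀ 0).1)
      ((hz'.comp measurable_subtype_coe).subtype_mk) measurable_const
      (hz' M.isClosed_latent.measurableSet)
  · filter_upwards [hFe] with w hw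
    have : (z (pastObs w)).re = (w 0).1 := by
      rw [show z (pastObs w) = (M.state w : ℂ) from hw.symm]
      rfl
    simp [this]

end LODM

/-! ### The joint law of an observation and the past observations -/

namespace ODM

open LODM

variable {p q : ℕ} {X Y T : Type*} [MeasurableSpace X] [MeasurableSpace Y] {M : ODM p q X Y T}

/-- Past observations are measurable for `past X Y 0`, so conditioning on it gives `P(past ∈ A, Y_0
∈ B)` as the integral of `G^θ(X_0; B)` over `past ∈ A`. With `X_0 = z (past)`, this identifies the
density on rectangles. -/
theorem IsStationarySolution.map_pastObs_obs {θ : T} {P : Measure (ℤ → X × Y)}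
    (h : M.IsStationarySolution θ P) {z : (ℕ → Y) → X} (hz : Measurable z)
    (hPz : ∀ᵐ w ∂P, (w 0).1 = z (pastObs w)) {g : X → Y → ℝ}
    (hg : Measurable (Function.uncurry g))
    (hgk : ∀ x, M.kernel θ x = M.ν.withDensity fun y => ENNReal.ofReal (g x y)) :
    P.map (fun w => (pastObs w, (w 0).2)) =
      ((P.map pastObs).prod M.ν).withDensity fun hy => ENNReal.ofReal (g (z hy.1) hy.2) := by
  have := h.isProbabilityMeasure
  have := M.sigmaFinite
  have := M.isMarkovKernel θ
  have hY : Measurable fun w : ℤ → X × Y => (w 0).2 :=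
    measurable_snd.comp (measurable_pi_apply 0)
  have hX : Measurable fun w : ℤ → X × Y => (w 0).1 :=
    measurable_fst.comp (measurable_pi_apply 0)
  have hH : Measurable (pastObs : (ℤ → X × Y) → ℕ → Y) := measurable_pastObs
  have hHpast : Measurable[past X Y 0] (pastObs : (ℤ → X × Y) → ℕ → Y) := by
    refine @measurable_pi_lambda _ _ _ (past X Y 0) _ _ fun n => ?_
    have hle : MeasurableSpace.comap (fun w : ℤ → X × Y => (w (-1 - (n : ℤ))).2) inferInstance ≤
        past X Y 0 :=
      le_sup_of_le_right (le_iSup (fun j : Iio (0 : ℤ) =>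
        MeasurableSpace.comap (fun w : ℤ → X × Y => (w j).2) inferInstance)
        ⟨-1 - (n : ℤ), by simp only [mem_Iio]; omega⟩)
    exact measurable_iff_comap_le.2 hle
  have hd : Measurable fun hy : (ℕ → Y) × Y => ENNReal.ofReal (g (z hy.1) hy.2) :=
    (hg.comp ((hz.comp measurable_fst).prodMk measurable_snd)).ennreal_ofReal
  have := Measure.isProbabilityMeasure_map (μ := P) (hH.prodMk hY).aemeasurable
  refine Measure.ext_prod fun {A B} hA hB => ?_
  rw [Measure.map_apply (hH.prodMk hY) (hA.prod hB), withDensity_apply _ (hA.prod hB),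
    setLIntegral_prod _ hd.aemeasurable]
  have hinner : ∀ x : ℕ → Y, ∫⁻ y in B, ENNReal.ofReal (g (z x) y) ∂M.ν = M.kernel θ (z x) B :=
    fun x => by rw [hgk, withDensity_apply _ hB]
  simp only [hinner]
  have hker : Measurable fun x => M.kernel θ x B := Kernel.measurable_coe _ hB
  have hkz : Measurable fun x => M.kernel θ (z x) B := hker.comp hz
  rw [setLIntegral_map hA hkz hH]
  have hcond := setIntegral_condExp (μ := P) (past_le X Y 0)
    ((integrable_const (1 : ℝ)).indicator (hY hB)) (hHpast hA)
  rw [setIntegral_congr_ae (g := fun w => (M.kernel θ (w 0).1).real B) (hH hA)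
    ((h.cond_law 0 B hB).mono fun w hw _ => hw), setIntegral_indicator (hY hB)] at hcond
  simp only [integral_const, smul_eq_mul, mul_one, measureReal_restrict_apply_univ] at hcond
  have hr : ∫⁻ w in pastObs ⁻¹' A, M.kernel θ (z (pastObs w)) B ∂P =
      ∫⁻ w in pastObs ⁻¹' A, M.kernel θ (w 0).1 B ∂P :=
    setLIntegral_congr_fun_ae (hH hA) (hPz.mono fun w hw _ => by rw [hw])
  rw [hr]
  have hfin : ∫⁻ w in pastObs ⁻¹' A, M.kernel θ (w 0).1 B ∂P ≠ ∞ := by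
    refine ne_top_of_le_ne_top (b := ∫⁻ w in pastObs ⁻¹' A, 1 ∂P) (by simp) ?_
    exact lintegral_mono fun w => prob_le_one
  have hto := integral_toReal (μ := P.restrict (pastObs ⁻¹' A))
    (f := fun w => M.kernel θ (w 0).1 B) (hker.comp hX).aemeasurable
    (Eventually.of_forall fun w => measure_lt_top _ _)
  rw [← ENNReal.toReal_eq_toReal_iff' (measure_ne_top _ _) hfin, ← hto]
  exact hcond.symm

end ODM

/-! ### The polynomials of the recursion -/

theorem polyQ_coeff {q : ℕ} (b : Fin q → ℝ) (k : Fin q) :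
    (polyQ b).coeff (q - 1 - (k : ℕ)) = b k := by
  simp only [polyQ, Polynomial.finsetSum_coeff, Polynomial.coeff_C_mul_X_pow]
  rw [Finset.sum_eq_single k]
  · simp
  · intro j _ hj
    rw [if_neg]
    intro h
    apply hj
    ext
    have := j.2
    have := k.2
    omega
  · simp

theorem polyQ_injective {q : ℕ} : Function.Injective (polyQ (q := q)) := fun b b' h =>
  funext fun k => by rw [← polyQ_coeff b k, h, polyQ_coeff]

theorem degree_polyQ_lt {q : ℕ} (b : Fin q → ℝ) : (polyQ b).degree < q := by
  rw [← Polynomial.mem_degreeLT]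
  refine Submodule.sum_mem _ fun k _ => ?_
  rw [Polynomial.mem_degreeLT]
  refine (Polynomial.degree_C_mul_X_pow_le _ _).trans_lt ?_
  have := k.2
  exact_mod_cast (by omega : q - 1 - (k : ℕ) < q)

theorem polyQ_of_natDegree_lt {n : ℕ} {R : ℝ[X]} (h : R.natDegree < n) :
    polyQ (fun k : Fin n => R.coeff (n - 1 - (k : ℕ))) = R := by
  conv_rhs => rw [R.as_sum_range' n h, ← Finset.sum_range_reflect, Finset.sum_range]
  simp only [polyQ, Polynomial.C_mul_X_pow_eq_monomial]

theorem polyQ_add_smul {q : ℕ} (b e : Fin q → ℝ) (t : ℝ) :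
    polyQ (b + t • e) = polyQ b + Polynomial.C t * polyQ e := by
  simp only [polyQ, Finset.mul_sum, ← Finset.sum_add_distrib]
  refine Finset.sum_congr rfl fun k _ => ?_
  simp only [Pi.add_apply, Pi.smul_apply, smul_eq_mul, map_add, map_mul]
  ring

theorem polyP_eq {p : ℕ} (a : Fin p → ℝ) : polyP a = Polynomial.X ^ p - polyQ a := by
  simp only [polyP, polyQ]
  congr 1
  exact Finset.sum_congr rfl fun k _ => by rw [Nat.sub_sub, add_comm 1]

theorem polyP_injective {p : ℕ} : Function.Injective (polyP (p := p)) := fun a a' h =>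
  polyQ_injective (by simpa [polyP_eq] using h)

theorem monic_polyP {p : ℕ} (a : Fin p → ℝ) : (polyP a).Monic := by
  rw [polyP_eq, sub_eq_add_neg]
  exact Polynomial.monic_X_pow_add (by rw [Polynomial.degree_neg]; exact degree_polyQ_lt a)

theorem natDegree_polyP {p : ℕ} (a : Fin p → ℝ) : (polyP a).natDegree = p := by
  refine Polynomial.natDegree_eq_of_degree_eq_some ?_
  rw [polyP_eq, Polynomial.degree_sub_eq_left_of_degree_lt, Polynomial.degree_X_pow]
  rw [Polynomial.degree_X_pow]
  exact degree_polyQ_lt a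

/-- `P` is the reciprocal polynomial: `P(z) = z^p (1 - ∑ a_k z^{-k})`. -/
theorem norm_lt_one_of_aeval_polyP {p : ℕ} {a : Fin p → ℝ} (ha : a ∈ invertibleCoeffs p) {z : ℂ}
    (hz : Polynomial.aeval z (polyP a) = 0) : ‖z‖ < 1 := by
  by_contra hle
  rw [not_lt] at hle
  have hz0 : z ≠ 0 := norm_pos_iff.1 (one_pos.trans_le hle)
  refine ha z⁻¹ (by rw [norm_inv]; exact inv_le_one_of_one_le₀ hle) ?_
  have h1 : z ^ p * (1 - ∑ k : Fin p, (a k : ℂ) * z⁻¹ ^ ((k : ℕ) + 1)) =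
      Polynomial.aeval z (polyP a) := by
    simp only [polyP, map_sub, map_sum, map_mul, map_pow, Polynomial.aeval_X, Polynomial.aeval_C,
      mul_sub, mul_one, Finset.mul_sum]
    congr 1
    refine Finset.sum_congr rfl fun k _ => ?_
    rw [pow_sub₀ z hz0 (Nat.succ_le_of_lt k.2), inv_pow, Nat.succ_eq_add_one]
    simp only [Complex.coe_algebraMap]
    ring
  rw [hz] at h1
  exact (mul_eq_zero.1 h1).resolve_left (pow_ne_zero _ hz0)

theorem eval_one_polyP_ne_zero {p : ℕ} {a : Fin p → ℝ} (ha : a ∈ invertibleCoeffs p) :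
    (polyP a).eval 1 ≠ 0 := by
  intro h
  have h1 : Polynomial.aeval (algebraMap ℝ ℂ 1) (polyP a) = 0 := by
    rw [Polynomial.aeval_algebraMap_apply_eq_algebraMap_eval, h, map_zero]
  simpa using norm_lt_one_of_aeval_polyP ha h1

namespace LODM

variable {p q : ℕ} {Y Φ : Type*} [MeasurableSpace Y] {M : LODM p q Y Φ}

/-! ### Identification of the parameters -/

/-- A nonzero polynomial in the shift does not map the observations to a constant. -/
theorem eq_zero_of_aeval_obs {P : Measure (ℤ → M.latent × Y)} [IsProbabilityMeasure P]
    (hP : P.map (fun w k => w (k + 1)) = P)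
    (hac : (P.map pastObs).prod M.toODM.ν ≪ P.map fun w => (pastObs w, (w 0).2)) {R : ℝ[X]} {c : ℝ}
    (h : ∀ᵐ w ∂P, Polynomial.aeval (koopman ℝ (shift 1)) R M.obs w = c) : R = 0 := by
  by_contra hR
  have := M.toODM.sigmaFinite
  have hr : R.leadingCoeff ≠ 0 := Polynomial.leadingCoeff_ne_zero.2 hR
  set d := R.natDegree with hd
  -- After a shift by `-d`, the leading term involves `Y_0` and the term of degree `n < d` involves
  -- `Y_{n-d}`, which is entry `d - 1 - n` of the past.
  set G : (ℕ → Y) × Y → ℝ := fun hy =>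
    ∑ n ∈ Finset.range d, R.coeff n * M.Υ (hy.1 (d - 1 - n)) + R.leadingCoeff * M.Υ hy.2 with hG
  have hGm : Measurable G := by
    refine (Finset.measurable_sum _ fun n _ => ?_).add
      ((M.measurable_Υ.comp measurable_snd).const_mul _)
    exact (M.measurable_Υ.comp ((measurable_pi_apply _).comp measurable_fst)).const_mul _
  have hmeas : Measurable fun w : ℤ → M.latent × Y => (pastObs w, (w 0).2) :=
    measurable_pastObs.prodMk (measurable_snd.comp (measurable_pi_apply 0))
  have h1 : ∀ᵐ w ∂P, G (pastObs w, (w 0).2) = c := by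
    filter_upwards [(measurePreserving_shift hP (-d)).quasiMeasurePreserving.ae h] with w hw
    rw [← hw, aeval_koopman_apply, ← hd, Finset.sum_range_succ, hG]
    simp only [pastObs, obs, shift_iterate, shift]
    congr 1
    · refine Finset.sum_congr rfl fun n hn => ?_
      have := Finset.mem_range.1 hn
      congr 4
      omega
    · simp [hd]
  have h2 : ∀ᵐ hy ∂(P.map pastObs).prod M.toODM.ν, G hy = c :=
    hac.ae_le ((ae_map_iff hmeas.aemeasurable (hGm (measurableSet_singleton c))).2 h1)
  have := Measure.isProbabilityMeasure_map (μ := P)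
    (measurable_pastObs (X := M.latent) (Y := Y)).aemeasurable
  -- For one frozen past, `Υ` is `ν`-almost everywhere equal to a constant, which contradicts the
  -- two points in the support.
  obtain ⟨h', hh'⟩ := (Measure.ae_ae_of_ae_prod h2).exists
  set s : ℝ := (c - ∑ n ∈ Finset.range d, R.coeff n * M.Υ (h' (d - 1 - n))) / R.leadingCoeff
  have h3 : ({s} : Set ℝ) ∈ ae (M.toODM.ν.map M.Υ) := by
    refine (ae_map_iff (p := fun x => x ∈ ({s} : Set ℝ)) M.measurable_Υ.aemeasurable
      (measurableSet_singleton s)).2 ?_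
    filter_upwards [hh'] with y hy
    rw [mem_singleton_iff, eq_div_iff hr, ← hy, hG]
    ring
  have h4 := Measure.support_subset_of_isClosed isClosed_singleton h3
  obtain ⟨y, hy, y', hy', hne⟩ := M.nondegenerate
  exact hne ((h4 hy).trans (h4 hy').symm)

/-- Applying `P'(U)` to the recursion of `v` and `P(U)` to that of `v'` eliminates the latent
variable, whence `P' Q = P Q'`. Coprimality gives `P' ∣ P`, and both are monic of degree `p`. The
intercepts then agree because `P'(1) ≠ 0`. -/
theorem eq_of_recursion {P : Measure (ℤ → M.latent × Y)} [IsProbabilityMeasure P]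
    (hP : P.map (fun w k => w (k + 1)) = P)
    (hac : (P.map pastObs).prod M.toODM.ν ≪ P.map fun w => (pastObs w, (w 0).2))
    {v v' : LinParam p q} (hv : M.Recursion v P) (hv' : M.Recursion v' P)
    (ha : v'.a ∈ invertibleCoeffs p)
    (hroot : ¬ HaveCommonRoot (polyP v'.a) (polyQ v'.b)) : v = v' := by
  set U := koopman ℝ (shift (E := M.latent × Y) 1)
  have hT := measurePreserving_shift hP 1
  have h1 := aeval_koopman_congr hT (polyP v'.a) ((recursion_iff hP).1 hv)
  have h2 := aeval_koopman_congr hT (polyP v.a) ((recursion_iff hP).1 hv')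
  have key : ∀ (R Q : ℝ[X]) (c : ℝ) (w : ℤ → M.latent × Y),
      Polynomial.aeval U R (fun w => c + Polynomial.aeval U Q M.obs w) w =
        R.eval 1 * c + Polynomial.aeval U (R * Q) M.obs w := by
    intro R Q c w
    have : (fun w => c + Polynomial.aeval U Q M.obs w) =
      (fun _ => c) + Polynomial.aeval U Q M.obs := rfl
    rw [this, map_add, aeval_koopman_const, map_mul]
    rfl
  have h3 : ∀ᵐ w ∂P, Polynomial.aeval U
      (polyP v'.a * (Polynomial.X ^ p * polyQ v.b) - polyP v.a * (Polynomial.X ^ p * polyQ v'.b))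
        M.obs w = (polyP v.a).eval 1 * v'.omega - (polyP v'.a).eval 1 * v.omega := by
    filter_upwards [h1, h2] with w hw1 hw2
    rw [key, ← Module.End.mul_apply, ← map_mul] at hw1 hw2
    rw [show polyP v'.a * (Polynomial.X ^ q * polyP v.a) =
      polyP v.a * (Polynomial.X ^ q * polyP v'.a) by ring, hw2] at hw1
    rw [map_sub, LinearMap.sub_apply, Pi.sub_apply]
    linear_combination -hw1
  have h4 := eq_zero_of_aeval_obs hP hac h3
  have h5 : polyP v'.a * polyQ v.b = polyP v.a * polyQ v'.b := by
    have : Polynomial.X ^ p * (polyP v'.a * polyQ v.b - polyP v.a * polyQ v'.b) = 0 := by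
      rw [← h4]
      ring
    exact sub_eq_zero.1 ((mul_eq_zero.1 this).resolve_left (pow_ne_zero _ Polynomial.X_ne_zero))
  have hcop : IsCoprime (polyP v'.a) (polyQ v'.b) := by
    refine (Polynomial.isCoprime_iff_aeval_ne_zero_of_isAlgClosed ℝ ℂ _ _).2 fun z => ?_
    by_contra! hz
    exact hroot ⟨z, hz⟩
  have hPP : polyP v.a = polyP v'.a := by
    have hdvd : polyP v'.a ∣ polyP v.a := hcop.dvd_of_dvd_mul_right ⟨_, h5.symm⟩
    exact (Polynomial.eq_of_monic_of_dvd_of_natDegree_le (monic_polyP _) (monic_polyP _) hdvd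
      (by rw [natDegree_polyP, natDegree_polyP]))
  have hQQ : polyQ v.b = polyQ v'.b := by
    rw [hPP] at h5
    exact mul_left_cancel₀ (monic_polyP _).ne_zero h5
  have hω : v.omega = v'.omega := by
    rw [h4, hPP] at h3
    obtain ⟨w, hw⟩ := h3.exists
    simp only [map_zero, LinearMap.zero_apply, Pi.zero_apply] at hw
    have : (polyP v'.a).eval 1 * v.omega = (polyP v'.a).eval 1 * v'.omega := by
      linear_combination hw
    exact mul_left_cancel₀ (eval_one_polyP_ne_zero ha) this
  ext i
  rcases i with ⟨⟩ | i | i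
  · exact hω
  · exact congrFun (polyP_injective hPP) i
  · exact congrFun (polyQ_injective hQQ) i

/-- Two stationary solutions with the same law of observations: the observation parameters agree,
and the first one satisfies the recursion of the second one. -/
theorem recursion_of_map_obs_eq {θ θs : M.Θ} {P Ps : Measure (ℤ → M.latent × Y)}
    (hA2 : ∀ x x' : M.latent,
      M.toODM.kernel θ x = M.toODM.kernel θs x' → θ.1.2 = θs.1.2 ∧ x = x')
    (ha : θ.1.1.a ∈ invertibleCoeffs p) (has : θs.1.1.a ∈ invertibleCoeffs p)
    (h : M.toODM.IsStationarySolution θ P) (hs : M.toODM.IsStationarySolution θs Ps)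
    (hobs : P.map (fun w k => (w k).2) = Ps.map fun w k => (w k).2) :
    (P.map pastObs).prod M.toODM.ν ≪ P.map (fun w => (pastObs w, (w 0).2)) ∧
      θ.1.2 = θs.1.2 ∧ M.Recursion θs.1.1 P := by
  have := h.isProbabilityMeasure
  have := hs.isProbabilityMeasure
  have := M.toODM.sigmaFinite
  obtain ⟨z, hz, hzP⟩ := exists_measurable_state h.stationary (recursion_of_isStationarySolution h) ha
  obtain ⟨zs, hzs, hzsP⟩ :=
    exists_measurable_state hs.stationary (recursion_of_isStationarySolution hs) has
  obtain ⟨g, hg, hgpos, hgk⟩ := M.toODM.dominated θ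
  obtain ⟨gs, hgs, -, hgsk⟩ := M.toODM.dominated θs
  have hO : Measurable fun (w : ℤ → M.latent × Y) (k : ℤ) => (w k).2 :=
    measurable_pi_lambda _ fun k => measurable_snd.comp (measurable_pi_apply k)
  have hB : Measurable fun (y : ℤ → Y) (n : ℕ) => y (-1 - n) :=
    measurable_pi_lambda _ fun n => measurable_pi_apply _
  have hmapH : ∀ Q : Measure (ℤ → M.latent × Y),
      Q.map pastObs = (Q.map fun w k => (w k).2).map fun y n => y (-1 - (n : ℕ)) := fun Q => by
    rw [Measure.map_map hB hO]
    rfl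
  have hmapJ : ∀ Q : Measure (ℤ → M.latent × Y), Q.map (fun w => (pastObs w, (w 0).2)) =
      (Q.map fun w k => (w k).2).map fun y => ((fun n : ℕ => y (-1 - n)), y 0) := fun Q => by
    rw [Measure.map_map (hB.prodMk (measurable_pi_apply 0)) hO]
    rfl
  have hρ : P.map pastObs = Ps.map pastObs := by rw [hmapH, hmapH, hobs]
  have hJ := h.map_pastObs_obs hz hzP hg hgk
  have hJs := hs.map_pastObs_obs hzs hzsP hgs hgsk
  rw [hmapJ, ← hobs, ← hmapJ, ← hρ, hJ] at hJs
  have hd : Measurable fun hy : (ℕ → Y) × Y => ENNReal.ofReal (g (z hy.1) hy.2) :=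
    (hg.comp ((hz.comp measurable_fst).prodMk measurable_snd)).ennreal_ofReal
  have hds : Measurable fun hy : (ℕ → Y) × Y => ENNReal.ofReal (gs (zs hy.1) hy.2) :=
    (hgs.comp ((hzs.comp measurable_fst).prodMk measurable_snd)).ennreal_ofReal
  have := Measure.isProbabilityMeasure_map (μ := P)
    (measurable_pastObs (X := M.latent) (Y := Y)).aemeasurable
  have hker : ∀ᵐ x ∂P.map pastObs, θ.1.2 = θs.1.2 ∧ z x = zs x := by
    -- For almost every past the two densities in `y` agree `ν`-almost everywhere, so the kernels at
    -- `z x` and `zs x` coincide.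
    filter_upwards [Measure.ae_ae_of_ae_prod
      ((withDensity_eq_iff_of_sigmaFinite hd.aemeasurable hds.aemeasurable).1 hJs)] with x hx
    refine hA2 _ _ ?_
    rw [hgk, hgsk]
    exact withDensity_congr_ae hx
  refine ⟨?_, hker.exists.choose_spec.1, fun k => ?_⟩
  -- Positivity of the density makes the product measure absolutely continuous with respect to the
  -- joint law.
  · rw [hJ]
    exact withDensity_absolutelyContinuous' hd.aemeasurable
      (Eventually.of_forall fun hy => by simp [hgpos])
  have hrec : ∀ {Q : Measure (ℤ → M.latent × Y)} (_ : Q.map (fun w k => w (k + 1)) = Q)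
      (_ : ∀ᵐ w ∂Q, (w 0).1 = zs (pastObs w)), ∀ᵐ w ∂Q, ∀ k : ℤ,
        (w k).1 = zs (fun n => (w (k - 1 - (n : ℕ))).2) := by
    intro Q hQ hQz
    refine ae_all_iff.2 fun k => ?_
    filter_upwards [(measurePreserving_shift hQ k).quasiMeasurePreserving.ae hQz] with w hw
    simp only [shift, zero_add] at hw
    rw [hw]
    congr 1
    funext n
    simp only [pastObs, shift]
    congr 2
    ring
  have hzsP' : ∀ᵐ w ∂P, (w 0).1 = zs (pastObs w) := by
    filter_upwards [hzP, ae_of_ae_map measurable_pastObs.aemeasurable hker] with w hw hw'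
    rw [hw, hw'.2]
  -- The recursion of `θs` at time `k`, with every latent variable replaced by `zs` of its past, is
  -- an event about observations alone and so transfers from `Ps` to `P`.
  set E : Set (ℤ → Y) := {y | (zs (fun n => y (k + 1 - 1 - (n : ℕ))) : ℝ) = θs.1.1.omega +
    ∑ i, θs.1.1.a i * (zs (fun n => y (k - ((i : ℕ) : ℤ) - 1 - (n : ℕ))) : ℝ) +
      ∑ j, θs.1.1.b j * M.Υ (y (k - ((j : ℕ) : ℤ)))} with hE
  have hEm : MeasurableSet E := by
    have hzm : ∀ l : ℤ, Measurable fun y : ℤ → Y => (zs fun n => y (l - 1 - (n : ℕ)) : ℝ) :=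
      fun l => measurable_subtype_coe.comp
        (hzs.comp (measurable_pi_lambda _ fun n => measurable_pi_apply _))
    refine measurableSet_eq_fun (hzm _) ((measurable_const.add
      (Finset.measurable_sum _ fun i _ => (hzm _).const_mul _)).add
      (Finset.measurable_sum _ fun j _ =>
        (M.measurable_Υ.comp (measurable_pi_apply _)).const_mul _))
  have hEs : ∀ᵐ y ∂(Ps.map fun w k => (w k).2), y ∈ E := by
    refine (ae_map_iff hO.aemeasurable hEm).2 ?_
    filter_upwards [hrec hs.stationary hzsP, recursion_of_isStationarySolution hs k] with w hw hw'
    simp only [hw] at hw'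
    exact hw'
  rw [← hobs] at hEs
  filter_upwards [ae_of_ae_map hO.aemeasurable hEs, hrec h.stationary hzsP'] with w hw hw'
  simp only [hw']
  exact hw

/-! ### The direction along which the parameters are not identified -/

/-- A real polynomial in the shift with all its complex roots in the open unit disc is injective,
up to almost sure equality. -/
theorem ae_eq_zero_of_aeval_real {P : Measure (ℤ → M.latent × Y)} [IsProbabilityMeasure P]
    (hP : P.map (fun w k => w (k + 1)) = P) {D : ℝ[X]} (hD0 : D ≠ 0)
    (hD : ∀ z : ℂ, Polynomial.aeval z D = 0 → ‖z‖ < 1) {f : (ℤ → M.latent × Y) → ℝ}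
    (hf : Measurable f) (h : Polynomial.aeval (koopman ℝ (shift 1)) D f =ᵐ[P] 0) : f =ᵐ[P] 0 := by
  have hC : (fun w => (f w : ℂ)) =ᵐ[P] 0 := by
    refine ae_eq_zero_of_aeval_koopman (measurePreserving_shift hP 1)
      (Complex.measurable_ofReal.comp hf) (D.map (algebraMap ℝ ℂ))
      ((Polynomial.map_ne_zero_iff (algebraMap ℝ ℂ).injective).2 hD0) (fun z hz => hD z ?_) ?_
    · rwa [Polynomial.IsRoot, Polynomial.eval_map_algebraMap] at hz
    · filter_upwards [h] with w hw
      rw [aeval_koopman_ofReal, hw]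
      simp
  filter_upwards [hC] with w hw
  simpa using hw

/-- With `P = D P₁` and `Q = D Q₁`, the process satisfies the reduced recursion `U^q P₁(U) X = c +
U^p Q₁(U) Υ`. Adding `t` times this one to the original replaces `(P, Q, ω)` by `(P + t P₁, Q + t
Q₁, ω + t c)`. The new `P` is still monic of degree `p`. -/
theorem exists_direction (hq : 0 < q) {v : LinParam p q}
    (ha : v.a ∈ invertibleCoeffs p) (hroot : HaveCommonRoot (polyP v.a) (polyQ v.b)) :
    ∃ d : LinParam p q, d ≠ 0 ∧ d.b ⟨0, hq⟩ = 0 ∧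
      ∀ (P : Measure (ℤ → M.latent × Y)) [IsProbabilityMeasure P]
        (_ : P.map (fun w k => w (k + 1)) = P) (_ : M.Recursion v P) (t : ℝ),
        M.Recursion (v + t • d) P := by
  obtain ⟨z, hzP, hzQ⟩ := hroot
  have hint : IsIntegral ℝ z := Algebra.IsIntegral.isIntegral z
  -- Over `ℝ`, the minimal polynomial of the common complex root is a nonconstant common factor.
  set D := minpoly ℝ z
  obtain ⟨P₁, hP₁⟩ : D ∣ polyP v.a := minpoly.dvd ℝ z hzP
  obtain ⟨Q₁, hQ₁⟩ : D ∣ polyQ v.b := minpoly.dvd ℝ z hzQ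
  have hDdeg : 0 < D.natDegree := minpoly.natDegree_pos hint
  have hD0 : D ≠ 0 := minpoly.ne_zero hint
  have hP₁0 : P₁ ≠ 0 := by
    rintro rfl
    exact (monic_polyP v.a).ne_zero (by rw [hP₁, mul_zero])
  have hP₁deg : P₁.natDegree < p := by
    have := natDegree_polyP v.a
    rw [hP₁, Polynomial.natDegree_mul hD0 hP₁0] at this
    omega
  -- Dividing by `D` lowers the degree below `q - 1`, so the coefficient of `z^{q-1}`, which is that
  -- of `b_1`, does not move.
  have hQ₁deg : Q₁ = 0 ∨ Q₁.natDegree < q - 1 := by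
    by_cases h0 : Q₁ = 0
    · exact Or.inl h0
    · right
      have h1 : polyQ v.b ≠ 0 := by
        rw [hQ₁]
        exact mul_ne_zero hD0 h0
      have h2 := (Polynomial.natDegree_lt_iff_degree_lt h1).2 (degree_polyQ_lt v.b)
      rw [hQ₁, Polynomial.natDegree_mul hD0 h0] at h2
      omega
  have hQ₁deg' : Q₁.natDegree < q := by
    rcases hQ₁deg with rfl | h
    · simpa using hq
    · omega
  have hDroot : ∀ y : ℂ, Polynomial.aeval y D = 0 → ‖y‖ < 1 := fun y hy =>
    norm_lt_one_of_aeval_polyP ha (by rw [hP₁, map_mul, hy, zero_mul])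
  have hD1 : D.eval 1 ≠ 0 := fun h =>
    eval_one_polyP_ne_zero ha (by rw [hP₁, Polynomial.eval_mul, h, zero_mul])
  set da : Fin p → ℝ := fun k => P₁.coeff (p - 1 - (k : ℕ))
  set db : Fin q → ℝ := fun k => Q₁.coeff (q - 1 - (k : ℕ)) with hdb
  have hda' : polyQ da = P₁ := polyQ_of_natDegree_lt hP₁deg
  have hdb' : polyQ db = Q₁ := polyQ_of_natDegree_lt hQ₁deg'
  -- `D(U)` multiplies constants by `D(1)`, so `D(U) c = ω`.
  set c : ℝ := v.omega / D.eval 1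
  -- The minus sign is there because the coefficients `a` enter `P` negatively.
  set d : LinParam p q := WithLp.toLp 2 (Sum.elim (fun _ => c) (Sum.elim (-da) db))
  have hdA : d.a = -da := rfl
  have hdB : d.b = db := rfl
  refine ⟨d, fun h => hP₁0 ?_, ?_, fun P _ hP hrec t => ?_⟩
  · have h1 : -da = 0 := by
      rw [← hdA, h]
      rfl
    rw [← hda', neg_eq_zero.1 h1]
    simp [polyQ]
  · rw [hdB, hdb]
    rcases hQ₁deg with h | h
    · simp [h]
    · exact Polynomial.coeff_eq_zero_of_natDegree_lt h
  · have h1 := (recursion_iff hP).1 hrec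
    refine (recursion_iff hP).2 ?_
    set U := koopman ℝ (shift (E := M.latent × Y) 1)
    have hA : polyP (v + t • d).a = polyP v.a + Polynomial.C t * P₁ := by
      rw [show (v + t • d).a = v.a + (-t) • da by
        funext k
        change v.a k + t * d.a k = _
        simp [hdA], polyP_eq, polyP_eq, polyQ_add_smul, hda', map_neg]
      ring
    have hB : polyQ (v + t • d).b = polyQ v.b + Polynomial.C t * Q₁ := by
      rw [show (v + t • d).b = v.b + t • db from rfl, polyQ_add_smul, hdb']
    have ho : (v + t • d).omega = v.omega + t * c := rfl
    -- `D(U)` maps this difference to the original recursion, which vanishes, and `D(U)` is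
    -- injective.
    have hcancel : (Polynomial.aeval U (Polynomial.X ^ q * P₁) M.state -
        Polynomial.aeval U (Polynomial.X ^ p * Q₁) M.obs - fun _ => c) =ᵐ[P] 0 := by
      refine ae_eq_zero_of_aeval_real hP hD0 hDroot
        (((measurable_aeval_koopman (measurable_shift 1) _ M.measurable_state).sub
          (measurable_aeval_koopman (measurable_shift 1) _ M.measurable_obs)).sub
            measurable_const) ?_
      filter_upwards [h1] with w hw
      rw [map_sub, map_sub, aeval_koopman_const, ← Module.End.mul_apply, ← Module.End.mul_apply,
        ← map_mul, ← map_mul]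
      rw [show D * (Polynomial.X ^ q * P₁) = Polynomial.X ^ q * polyP v.a by rw [hP₁]; ring,
        show D * (Polynomial.X ^ p * Q₁) = Polynomial.X ^ p * polyQ v.b by rw [hQ₁]; ring]
      simp only [U] at hw
      simp only [Pi.sub_apply, Pi.zero_apply, hw, c]
      field_simp
      ring
    filter_upwards [h1, hcancel] with w hw hw'
    have hsmul : ∀ (R : ℝ[X]) (f : (ℤ → M.latent × Y) → ℝ),
        Polynomial.aeval U (Polynomial.C t * R) f w = t * Polynomial.aeval U R f w := fun R f => by
      simp [Module.End.mul_apply]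
    rw [hA, hB, ho, mul_add, mul_add, map_add, map_add, LinearMap.add_apply, LinearMap.add_apply,
      Pi.add_apply, Pi.add_apply, hw, mul_left_comm, mul_left_comm _ (Polynomial.C t), hsmul, hsmul]
    simp only [Pi.sub_apply, Pi.zero_apply] at hw'
    linear_combination t * hw'

end LODM

/-- The endpoints differ, so the variation is positive; the map is `‖d‖`-Lipschitz, so it is finite.
-/
theorem eVariationOn_segment {E : Type*} [NormedAddCommGroup E] [NormedSpace ℝ E] (v d : E)
    (hd : d ≠ 0) :
    0 < eVariationOn (fun t : ℝ => v + t • d) (Icc 0 1) ∧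
      eVariationOn (fun t : ℝ => v + t • d) (Icc 0 1) < ∞ := by
  constructor
  · rw [pos_iff_ne_zero, Ne, eVariationOn.eq_zero_iff]
    intro h
    have := h 0 (by simp) 1 (by simp)
    simp [edist_eq_zero, hd] at this
  · have hL : LipschitzOnWith ‖d‖₊ (fun t : ℝ => v + t • d) (Icc 0 1) := by
      refine LipschitzOnWith.of_dist_le_mul fun x _ y _ => ?_
      rw [dist_add_left, dist_eq_norm, ← sub_smul, norm_smul, dist_eq_norm, mul_comm, coe_nnnorm]
    have h1 := hL.comp_eVariationOn_le (g := id) (s := Icc (0 : ℝ) 1) (mapsTo_id _)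
    refine h1.trans_lt (ENNReal.mul_lt_top ENNReal.coe_lt_top ?_)
    have h2 := (monotone_id.monotoneOn (Icc (0 : ℝ) 1)).eVariationOn_eq
      (left_mem_Icc.2 zero_le_one) (right_mem_Icc.2 zero_le_one)
    rw [inter_self] at h2
    rw [h2]
    exact ENNReal.ofReal_lt_top

end

theorem mainTheorem1 {p q : ℕ} (hp : 1 ≤ p) (hq : 1 ≤ q) {Y Φ : Type*} [MeasurableSpace Y]
    (M : LODM p q Y Φ)
    (hA1 : M.toODM.UniquelyStationary)
    (hmoment : ∀ θ : M.Θ,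
      ∫⁻ y, ENNReal.ofReal (Real.posLog |M.Υ y|) ∂(M.toODM.observationMarginal hA1 θ) < ∞)
    (θs : M.Θ)
    (hA2 : ∀ (θ : M.Θ) (x x' : M.latent),
      M.toODM.kernel θ x = M.toODM.kernel θs x' ↔ θ.1.2 = θs.1.2 ∧ x = x')
    (hL1 : ∀ θ : M.Θ, θ.1.1.a ∈ invertibleCoeffs p) :
    (¬ HaveCommonRoot (polyP θs.1.1.a) (polyQ θs.1.1.b) →
      M.toODM.equivClass hA1 θs = {θs}) ∧
    (HaveCommonRoot (polyP θs.1.1.a) (polyQ θs.1.1.b) →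
      (∀ᶠ v in 𝓝 θs.1.1, v.b ⟨0, hq⟩ = θs.1.1.b ⟨0, hq⟩ → (v, θs.1.2) ∈ M.Θ) →
      ∃ γ : ℝ → LinParam p q,
        ContinuousOn γ (Icc 0 1) ∧
        (∀ t ∈ Icc (0 : ℝ) 1, ∃ h : (γ t, θs.1.2) ∈ M.Θ,
          (⟨(γ t, θs.1.2), h⟩ : M.Θ) ∈ M.toODM.equivClass hA1 θs) ∧
        (∃ t ∈ Icc (0 : ℝ) 1, γ t = θs.1.1) ∧
        0 < eVariationOn γ (Icc 0 1) ∧ eVariationOn γ (Icc 0 1) < ∞) := by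
  have hspec := M.toODM.stationaryLaw_spec hA1
  refine ⟨fun hroot => ?_, fun hroot hnhds => ?_⟩
  · refine Subset.antisymm (fun θ hθ => ?_) (singleton_subset_iff.2 rfl)
    have := (hspec θ).isProbabilityMeasure
    obtain ⟨hac, hφ, hrec⟩ := LODM.recursion_of_map_obs_eq (fun x x' => (hA2 θ x x').1)
      (hL1 θ) (hL1 θs) (hspec θ) (hspec θs) hθ
    have hϑ := LODM.eq_of_recursion (hspec θ).stationary hac
      (LODM.recursion_of_isStationarySolution (hspec θ)) hrec (hL1 θs) hroot
    exact Subtype.ext (Prod.ext hϑ hφ)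
  · have := (hspec θs).isProbabilityMeasure
    obtain ⟨d, hd0, hdb, hd⟩ := LODM.exists_direction (M := M) hq (hL1 θs) hroot
    have hcont : Tendsto (fun s : ℝ => θs.1.1 + s • d) (𝓝 0) (𝓝 θs.1.1) := by
      have : Continuous fun s : ℝ => θs.1.1 + s • d := by fun_prop
      simpa using this.tendsto 0
    -- The segment is scaled by `ε / 2` to stay where the neighbourhood condition applies; `d.b`
    -- vanishes at entry 0, so the constraint on `b_1` holds along it.
    obtain ⟨ε, hε, hball⟩ := Metric.eventually_nhds_iff.1 (hcont.eventually hnhds)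
    have hmem : ∀ t ∈ Icc (0 : ℝ) 1, (θs.1.1 + t • ((ε / 2) • d), θs.1.2) ∈ M.Θ := by
      intro t ht
      rw [smul_smul]
      refine hball ?_ ?_
      · rw [Real.dist_eq, sub_zero, abs_of_nonneg (mul_nonneg ht.1 (half_pos hε).le)]
        nlinarith [ht.2]
      · change θs.1.1.b _ + _ * d.b _ = _
        rw [hdb, mul_zero, add_zero]
    refine ⟨fun t => θs.1.1 + t • ((ε / 2) • d), by fun_prop, fun t ht => ⟨hmem t ht, ?_⟩,
      ⟨0, by simp, by simp⟩,
      eVariationOn_segment _ _ (smul_ne_zero (half_pos hε).ne' hd0)⟩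
    -- The stationary law of `θs` itself solves the model at the new parameter: the recursion holds
    -- along `d`, and the kernels depend only on `φ`, by the converse direction of `hA2`.
    have hsol : M.toODM.IsStationarySolution ⟨_, hmem t ht⟩ (M.toODM.stationaryLaw hA1 θs) := by
      refine ⟨(hspec θs).isProbabilityMeasure, (hspec θs).stationary, fun k => ?_, fun k A hA => ?_⟩
      · have hrec := hd _ (hspec θs).stationary
          (LODM.recursion_of_isStationarySolution (hspec θs)) (t * (ε / 2))
        rw [mul_smul] at hrec
        filter_upwards [hrec k] with w hw
        exact Subtype.ext (by rw [hw, M.link_affine])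
      · have hk : ∀ x, M.toODM.kernel ⟨_, hmem t ht⟩ x = M.toODM.kernel θs x :=
          fun x => (hA2 _ x x).2 ⟨rfl, rfl⟩
        simp only [hk]
        exact (hspec θs).cond_law k A hA
    have heq := (hA1 ⟨_, hmem t ht⟩).unique (hspec _) hsol
    simp only [ODM.equivClass, ODM.observationLaw, mem_ofPred_eq, heq]
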